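/- Let $p$ be a prime number and let $P=\sum_{i=1}^{p-1}\frac{(p-1)!}{i!(p-i)!}X^iY^{p-i}\in\mathbf Z[X,Y]$. For a commutative ring $A$ and an $A$-module $M$, a map $w\colon A\to M$ is called an FW-derivation if $w(a+b)=w(a)+w(b)-P(a,b)\cdot w(p)$ and $w(ab)=b^p\cdot w(a)+a^p\cdot w(b)$ for all $a,b\in A$. Let $w\colon A\to F\Omega^1_A$ denote the universal FW-derivation: $F\Omega^1_A$ is the quotient of the free $A$-module on symbols $[a]$ $(a\in A)$ by the submodule generated by the elements $[a+b]-[a]-[b]+P(a,b)[p]$ and $[ab]-a^p[b]-b^p[a]$ for $a,b\in A$, and $w(a)$ is the class of $[a]$. Let $A$ be a local ring (commutative, not necessarily noetherian) with maximal ideal $\mathfrak m_A$ whose residue field $k=A/\mathfrak m_A$ is of characteristic $p$. For a $k$-vector space $M$, let $F^*M=M\otimes_k k$ be the scalar extension by the Frobenius $F\colon k\to k$, $x\mapsto x^p$, and let $\Omega^1_k=\Omega^1_{k/\mathbf Z}$ be the module of absolute Kähler differentials. Then the sequence of $k$-vector spaces $$0\longrightarrow F^*(\mathfrak m_A/\mathfrak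 m_A^2)\longrightarrow F\Omega^1_A\otimes_A k\longrightarrow F^*\Omega^1_k\longrightarrow 0$$ is exact. Here the first map is the $k$-linear map induced by $w$, that is, $\bar a\otimes c\mapsto w(a)\otimes c$ for $a\in\mathfrak m_A$ and $c\in k$, and the second is the $k$-linear map characterized by $w(a)\otimes c\mapsto d\bar a\otimes c$ for $a\in A$ and $c\in k$, where $\bar a\in k$ is the image of $a$. -/

import Mathlib

open scoped TensorProduct

noncomputable section

namespace FrobeniusWitt

universe u v

/-! ### Frobenius-Witt derivations -/

section Derivations

variable {A : Type u} [CommRing A] {M : Type v} [AddCommGroup M] [Module A M]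

/-- The value at `(a, b)` of the integral polynomial
`P = ∑_{i=1}^{p-1} (p-1)! / (i! (p-i)!) · X^i Y^{p-i} = ((X + Y)^p - X^p - Y^p) / p`.
For `p` prime the divisions of natural numbers are exact. -/
def wittP (p : ℕ) (a b : A) : A :=
  ∑ i ∈ Finset.Ico 1 p,
    (((p - 1).factorial / (i.factorial * (p - i).factorial) : ℕ) : A) * a ^ i * b ^ (p - i)

/-- The coefficients of `wittP` are exact quotients: `p · P(a, b) = (a + b)^p - a^p - b^p`. -/
theorem natCast_mul_wittP (p : ℕ) [hp : Fact p.Prime] (a b : A) :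
    (p : A) * wittP p a b = (a + b) ^ p - a ^ p - b ^ p := by
  have key : ∀ i ∈ Finset.Ico 1 p,
      p * ((p - 1).factorial / (i.factorial * (p - i).factorial)) = p.choose i := by
    intro i hi
    obtain ⟨h1, h2⟩ := Finset.mem_Ico.mp hi
    obtain ⟨c, hc⟩ := hp.out.dvd_choose_self (by omega) h2
    have hpos : 0 < i.factorial * (p - i).factorial :=
      Nat.mul_pos i.factorial_pos (p - i).factorial_pos
    have h3 := Nat.choose_mul_factorial_mul_factorial h2.le
    rw [← Nat.mul_factorial_pred hp.out.ne_zero, hc] at h3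
    have h4 : (p - 1).factorial = c * (i.factorial * (p - i).factorial) := by
      apply Nat.eq_of_mul_eq_mul_left hp.out.pos
      rw [← h3]; ring
    rw [h4, Nat.mul_div_cancel _ hpos, hc]
  have h0 : (a + b) ^ p = b ^ p + (p : A) * wittP p a b + a ^ p := by
    rw [add_pow, Finset.sum_range_succ, Finset.range_eq_Ico,
      Finset.sum_eq_sum_Ico_succ_bot hp.out.pos, wittP, Finset.mul_sum]
    simp only [pow_zero, Nat.sub_zero, Nat.choose_zero_right, Nat.cast_one, mul_one, one_mul,
      Nat.sub_self, Nat.choose_self, zero_add]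
    congr 2
    refine Finset.sum_congr rfl fun i hi => ?_
    rw [← key i hi]
    push_cast
    ring
  rw [h0]; ring

/-- A map `w : A → M` from a ring to an `A`-module is a Frobenius-Witt derivation if
`w (a + b) = w a + w b - P(a, b) · w p` and `w (a b) = b^p · w a + a^p · w b`. -/
structure IsFWDerivation (p : ℕ) (w : A → M) : Prop where
  map_add : ∀ a b : A, w (a + b) = w a + w b - wittP p a b • w (p : A)
  map_mul : ∀ a b : A, w (a * b) = b ^ p • w a + a ^ p • w b

/-- If `a` lies in an ideal, then so does `P(a, b)`. -/
theorem wittP_mem (p : ℕ) (I : Ideal A) {a : A} (ha : a ∈ I) (b : A) : wittP p a b ∈ I := by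
  refine I.sum_mem fun i hi => I.mul_mem_right _ (I.mul_mem_left _ ?_)
  exact I.pow_mem_of_mem ha i (Finset.mem_Ico.mp hi).1

/-- An additive map satisfying the `p`-power Leibniz rule is an FW-derivation. -/
theorem IsFWDerivation.of_add {p : ℕ} {w : A → M}
    (hadd : ∀ a b : A, w (a + b) = w a + w b) (hp0 : w (p : A) = 0)
    (hmul : ∀ a b : A, w (a * b) = b ^ p • w a + a ^ p • w b) : IsFWDerivation p w :=
  ⟨fun a b => by rw [hadd, hp0, smul_zero, sub_zero], hmul⟩

end Derivations

/-! ### The module of FW-differentials -/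

section Differentials

variable (p : ℕ) (A : Type u) [CommRing A]

/-- The relations `[a+b] - [a] - [b] + P(a,b)[p]` and `[ab] - a^p[b] - b^p[a]` in the free
`A`-module on the set `A`. -/
def relations : Submodule A (A →₀ A) :=
  Submodule.span A
    ({x | ∃ a b : A, x = Finsupp.single (a + b) 1 - Finsupp.single a 1 - Finsupp.single b 1
        + wittP p a b • Finsupp.single (p : A) 1} ∪
     {x | ∃ a b : A, x = Finsupp.single (a * b) 1 - a ^ p • Finsupp.single b 1
        - b ^ p • Finsupp.single a 1})

/-- The `A`-module `FΩ¹_A` of FW-differentials of `A`. -/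
abbrev FWDifferentials : Type u := (A →₀ A) ⧸ relations p A

variable {A}

/-- The universal FW-derivation `w : A → FΩ¹_A`. -/
def univW (a : A) : FWDifferentials p A :=
  (relations p A).mkQ (Finsupp.single a 1)

theorem isFWDerivation_univW : IsFWDerivation p (univW p : A → FWDifferentials p A) where
  map_add a b := by
    rw [← sub_eq_zero]
    unfold univW
    rw [← map_smul, ← map_add, ← map_sub, ← map_sub, Submodule.mkQ_apply,
      Submodule.Quotient.mk_eq_zero]
    refine Submodule.subset_span (Or.inl ⟨a, b, ?_⟩)
    abel
  map_mul a b := by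
    rw [← sub_eq_zero]
    unfold univW
    rw [← map_smul, ← map_smul, ← map_add, ← map_sub, Submodule.mkQ_apply,
      Submodule.Quotient.mk_eq_zero]
    refine Submodule.subset_span (Or.inr ⟨a, b, ?_⟩)
    abel

variable {p}
variable {M : Type v} [AddCommGroup M] [Module A M]

/-- The `A`-linear map `FΩ¹_A → M` attached to an FW-derivation `A → M`. -/
def liftFW {w : A → M} (hw : IsFWDerivation p w) : FWDifferentials p A →ₗ[A] M :=
  (relations p A).liftQ (Finsupp.linearCombination A w) (by
    rw [relations, Submodule.span_le]
    rintro x (⟨a, b, rfl⟩ | ⟨a, b, rfl⟩)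
    · simp only [SetLike.mem_coe, LinearMap.mem_ker, map_add, map_sub, map_smul,
        Finsupp.linearCombination_single, one_smul, hw.map_add a b]
      abel
    · simp only [SetLike.mem_coe, LinearMap.mem_ker, map_sub, map_smul,
        Finsupp.linearCombination_single, one_smul, hw.map_mul a b]
      abel)

@[simp]
theorem liftFW_univW {w : A → M} (hw : IsFWDerivation p w) (a : A) :
    liftFW hw (univW p a) = w a := by
  simp [liftFW, univW]

/-- Uniqueness in the universal property of `(FΩ¹_A, w)`. -/
theorem hom_ext_univW {f g : FWDifferentials p A →ₗ[A] M}
    (h : ∀ a, f (univW p a) = g (univW p a)) : f = g := by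
  apply Submodule.linearMap_qext
  ext a
  exact h a

end Differentials

/-! ### Scalar extension by the absolute Frobenius -/

section FrobeniusPullback

variable (p : ℕ) (k : Type u) [CommRing k] [ExpChar k p]

/-- The ring `k`, regarded as a `k`-algebra by the Frobenius `F : k → k`. -/
def FrobAlg (_p : ℕ) (k : Type u) : Type u := k

instance : CommRing (FrobAlg p k) := inferInstanceAs (CommRing k)

instance : Algebra k (FrobAlg p k) := (frobenius k p).toAlgebra

/-- The identity `k = FrobAlg p k`, as an isomorphism of rings (not of `k`-algebras). -/
def toFrobAlg : k ≃+* FrobAlg p k := RingEquiv.refl k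

/-- `F^*M`: the tensor product of `M` and `k` over `k` with respect to the Frobenius
`F : k → k`. The factor `k` is written on the left, and `c • x ⊗ m = c x ⊗ m`. -/
def FrobPullback (M : Type v) [AddCommGroup M] [Module k M] : Type (max u v) :=
  FrobAlg p k ⊗[k] M

variable {M : Type v} [AddCommGroup M] [Module k M]

instance : AddCommGroup (FrobPullback p k M) :=
  inferInstanceAs (AddCommGroup (FrobAlg p k ⊗[k] M))

instance : Module (FrobAlg p k) (FrobPullback p k M) :=
  inferInstanceAs (Module (FrobAlg p k) (FrobAlg p k ⊗[k] M))

instance : Module k (FrobPullback p k M) :=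
  Module.compHom _ (toFrobAlg p k).toRingHom

variable {k}

/-- The element `c ⊗ m` of `F^*M`. -/
def frobTmul (c : k) (m : M) : FrobPullback p k M :=
  toFrobAlg p k c ⊗ₜ[k] m

theorem smul_frobTmul (c d : k) (m : M) :
    c • frobTmul p d m = frobTmul p (c * d) m := rfl

theorem frobTmul_add (c : k) (m n : M) :
    frobTmul p c (m + n) = frobTmul p c m + frobTmul p c n :=
  TensorProduct.tmul_add (R := k) (toFrobAlg p k c) m n

theorem frobTmul_zero (c : k) : frobTmul p c (0 : M) = 0 :=
  TensorProduct.tmul_zero (R := k) _ (toFrobAlg p k c)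

theorem frobTmul_smul (c d : k) (m : M) :
    frobTmul p c (d • m) = frobTmul p (d ^ p * c) m :=
  TensorProduct.tmul_smul (R := k) d (toFrobAlg p k c) m

variable {p}
variable {N : Type*} [AddCommGroup N] [Module k N]

/-- The additive map underlying `frobLift`. -/
def frobLiftAdd (f : M →ₛₗ[frobenius k p] N) : FrobPullback p k M →+ N :=
  TensorProduct.liftAddHom (R := k) (M := FrobAlg p k) (N := M)
    (AddMonoidHom.mk' (fun c => AddMonoidHom.mk' (fun m => (toFrobAlg p k).symm c • f m)
        (fun x y => by rw [map_add, smul_add]))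
      (fun c d => by
        ext m
        change (toFrobAlg p k).symm (c + d) • f m = _
        rw [map_add, add_smul]
        rfl))
    (fun r c m => by
      change ((frobenius k p r : k) * (toFrobAlg p k).symm c) • f m
        = (toFrobAlg p k).symm c • f (r • m)
      rw [map_smulₛₗ, smul_smul, mul_comm])

theorem frobLiftAdd_frobTmul (f : M →ₛₗ[frobenius k p] N) (c : k) (m : M) :
    frobLiftAdd f (frobTmul p c m) = c • f m := rfl

theorem frobPullback_induction {motive : FrobPullback p k M → Prop} (zero : motive 0)
    (tmul : ∀ (c : k) (m : M), motive (frobTmul p c m))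
    (add : ∀ x y, motive x → motive y → motive (x + y)) (x : FrobPullback p k M) : motive x :=
  TensorProduct.induction_on (R := k) (M := FrobAlg p k) (N := M) (motive := motive) x zero
    tmul add

/-- The `k`-linear map `F^*M → N`, `c ⊗ m ↦ c • f m`, attached to a Frobenius-semilinear map
`f : M → N`. -/
def frobLift (f : M →ₛₗ[frobenius k p] N) : FrobPullback p k M →ₗ[k] N where
  toFun := frobLiftAdd f
  map_add' := map_add _
  map_smul' c x := by
    induction x using frobPullback_induction with
    | zero => rw [smul_zero, map_zero, smul_zero]
    | tmul d m =>
      rw [smul_frobTmul, frobLiftAdd_frobTmul, frobLiftAdd_frobTmul, mul_smul, RingHom.id_apply]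
    | add x y hx hy => rw [smul_add, map_add, map_add, smul_add, hx, hy]

@[simp]
theorem frobLift_frobTmul (f : M →ₛₗ[frobenius k p] N) (c : k) (m : M) :
    frobLift f (frobTmul p c m) = c • f m := rfl

end FrobeniusPullback

/-! ### FW-differentials: functoriality, and rings of characteristic `p` -/

section Functoriality

variable (p : ℕ) (A : Type u) [CommRing A] (B : Type v) [CommRing B] [Algebra A B]

theorem algebraMap_wittP (a b : A) :
    algebraMap A B (wittP p a b) = wittP p (algebraMap A B a) (algebraMap A B b) := by
  simp [wittP]

theorem isFWDerivation_univW_algebraMap :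
    IsFWDerivation p (fun a : A => univW p (algebraMap A B a)) where
  map_add a b := by
    rw [map_add, (isFWDerivation_univW p).map_add, ← algebraMap_wittP, map_natCast,
      algebraMap_smul]
  map_mul a b := by
    rw [map_mul, (isFWDerivation_univW p).map_mul, ← map_pow, ← map_pow, algebraMap_smul,
      algebraMap_smul]

/-- The canonical `B`-linear map `FΩ¹_A ⊗_A B → FΩ¹_B`. -/
def fwBaseChange : B ⊗[A] FWDifferentials p A →ₗ[B] FWDifferentials p B :=
  (liftFW (isFWDerivation_univW_algebraMap p A B)).liftBaseChange B

theorem fwBaseChange_tmul (b : B) (a : A) :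
    fwBaseChange p A B (b ⊗ₜ[A] univW p a) = b • univW p (algebraMap A B a) := by
  simp [fwBaseChange]

end Functoriality

section CharP

open KaehlerDifferential

variable (p : ℕ) (k : Type u) [CommRing k] [ExpChar k p]

theorem isFWDerivation_frobTmul_D :
    IsFWDerivation p (fun a : k => frobTmul p (1 : k) (D ℤ k a)) := by
  refine IsFWDerivation.of_add (fun a b => ?_) ?_ (fun a b => ?_)
  · rw [map_add, frobTmul_add]
  · rw [Derivation.map_natCast, frobTmul_zero]
  · rw [Derivation.leibniz, frobTmul_add, frobTmul_smul, frobTmul_smul, smul_frobTmul,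
      smul_frobTmul, add_comm]

/-- The canonical map `FΩ¹_k → F^*Ω¹_k` for a ring `k` of (exponential)
characteristic `p`, sending `w(a)`
to `1 ⊗ da`. Here `Ω¹_k` is the module of absolute Kähler differentials. -/
def fwToKaehler : FWDifferentials p k →ₗ[k] FrobPullback p k (Ω[k⁄ℤ]) :=
  liftFW (isFWDerivation_frobTmul_D p k)

theorem fwToKaehler_univW (a : k) :
    fwToKaehler p k (univW p a) = frobTmul p 1 (D ℤ k a) :=
  liftFW_univW _ a

variable (A : Type v) [CommRing A] [Algebra A k]

/-- The composition `FΩ¹_A ⊗_A k → FΩ¹_k → F^*Ω¹_k`, so `w(a) ⊗ c ↦ c ⊗ da`. -/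
def fwBaseChangeToKaehler : k ⊗[A] FWDifferentials p A →ₗ[k] FrobPullback p k (Ω[k⁄ℤ]) :=
  fwToKaehler p k ∘ₗ fwBaseChange p A k

theorem fwBaseChangeToKaehler_tmul (c : k) (a : A) :
    fwBaseChangeToKaehler p k A (c ⊗ₜ[A] univW p a)
      = frobTmul p c (D ℤ k (algebraMap A k a)) := by
  rw [fwBaseChangeToKaehler, LinearMap.comp_apply, fwBaseChange_tmul, map_smul,
    fwToKaehler_univW, smul_frobTmul, mul_one]

end CharP

/-! ### The two maps of the sequence of a local ring -/

section LocalRing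

open IsLocalRing

theorem smul_fibre_eq_zero (p : ℕ) {A : Type u} [CommRing A] [IsLocalRing A] {a : A} (ha : a ∈ maximalIdeal A) (x : FWDifferentials p A) :
    (1 : ResidueField A) ⊗ₜ[A] (a • x) = 0 := by
  rw [← TensorProduct.smul_tmul, Algebra.smul_def, ResidueField.algebraMap_eq,
    (residue_eq_zero_iff a).mpr ha, zero_mul, TensorProduct.zero_tmul]

variable (p : ℕ) [hp : Fact p.Prime] (A : Type u) [CommRing A] [IsLocalRing A]
  [CharP (ResidueField A) p]

/-- The fibre `FΩ¹_A ⊗_A k` (with the factor `k` written on the left). -/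
abbrev FWFibre : Type u := ResidueField A ⊗[A] FWDifferentials p A


/-- The map `𝔪_A → FΩ¹_A ⊗_A k`, `a ↦ w(a) ⊗ 1`, is semilinear with respect to the composition
`A → k → k` of the projection with the Frobenius. -/
def wMaximalIdeal :
    maximalIdeal A →ₛₗ[(frobenius (ResidueField A) p).comp (residue A)] FWFibre p A where
  toFun a := 1 ⊗ₜ[A] univW p (a : A)
  map_add' a b := by
    rw [Submodule.coe_add, (isFWDerivation_univW p).map_add, TensorProduct.tmul_sub,
      TensorProduct.tmul_add, smul_fibre_eq_zero p (wittP_mem p _ a.2 _), sub_zero]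
  map_smul' c a := by
    rw [Submodule.coe_smul, smul_eq_mul, (isFWDerivation_univW p).map_mul,
      TensorProduct.tmul_add,
      smul_fibre_eq_zero p (Ideal.pow_mem_of_mem _ a.2 p hp.out.pos), zero_add,
      RingHom.comp_apply, frobenius_def, ← map_pow, ← TensorProduct.smul_tmul,
      Algebra.smul_def, ResidueField.algebraMap_eq, mul_one, TensorProduct.smul_tmul',
      smul_eq_mul, mul_one]

/-- The Frobenius-semilinear map `𝔪_A/𝔪_A² → FΩ¹_A ⊗_A k` induced by `w`. -/
def wCotangent :
    CotangentSpace A →ₛₗ[frobenius (ResidueField A) p] FWFibre p A where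
  toFun := (maximalIdeal A • (⊤ : Submodule A (maximalIdeal A))).liftQ (wMaximalIdeal p A) (by
    rw [Submodule.smul_le]
    rintro a ha x -
    rw [LinearMap.mem_ker, map_smulₛₗ, RingHom.comp_apply, (residue_eq_zero_iff a).mpr ha,
      RingHom.map_zero, zero_smul])
  map_add' := map_add _
  map_smul' c x := by
    obtain ⟨c, rfl⟩ := residue_surjective c
    obtain ⟨x, rfl⟩ := (maximalIdeal A).toCotangent_surjective x
    exact (wMaximalIdeal p A).map_smulₛₗ c x

theorem wCotangent_toCotangent (a : maximalIdeal A) :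
    wCotangent p A ((maximalIdeal A).toCotangent a) = 1 ⊗ₜ[A] univW p (a : A) := rfl

/-- The first map `F^*(𝔪_A/𝔪_A²) → FΩ¹_A ⊗_A k`, induced by the universal FW-derivation. -/
def fwCotangentMap :
    FrobPullback p (ResidueField A) (CotangentSpace A) →ₗ[ResidueField A] FWFibre p A :=
  frobLift (wCotangent p A)

theorem fwCotangentMap_apply (c : ResidueField A) (a : maximalIdeal A) :
    fwCotangentMap p A (frobTmul p c ((maximalIdeal A).toCotangent a))
      = c ⊗ₜ[A] univW p (a : A) := by
  rw [fwCotangentMap, frobLift_frobTmul, wCotangent_toCotangent, TensorProduct.smul_tmul',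
    smul_eq_mul, mul_one]

/-- The second map `FΩ¹_A ⊗_A k → F^*Ω¹_k`: the canonical map to `FΩ¹_k` followed by
`FΩ¹_k → F^*Ω¹_k`, so `w(a) ⊗ c ↦ c ⊗ dā`. -/
def fwResidueMap :
    FWFibre p A →ₗ[ResidueField A] FrobPullback p (ResidueField A) (Ω[ResidueField A⁄ℤ]) :=
  fwBaseChangeToKaehler p (ResidueField A) A

theorem fwResidueMap_apply (c : ResidueField A) (a : A) :
    fwResidueMap p A (c ⊗ₜ[A] univW p a)
      = frobTmul p c (KaehlerDifferential.D ℤ (ResidueField A) (residue A a)) :=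
  fwBaseChangeToKaehler_tmul p (ResidueField A) A c a

end LocalRing

end FrobeniusWitt

end

/-!
Injectivity is the substance of the theorem. Write `k` for the residue field and put
`M = F^*(𝔪_A/𝔪_A²)`. It suffices to extend the Frobenius-semilinear map `φ : 𝔪_A → M`,
`a ↦ 1 ⊗ a`, to an FW-derivation `w : A → M`, since the linear map `FΩ¹_A ⊗_A k → M` that
corresponds to `w` is then a retraction of the first map of the sequence. The extension exists for
every `k`-vector space `M` and every such `φ` (`exists_isFWDerivation_extending`).

To find it, put `c = φ(p)`. The FW-derivations `w : A → M` with `w(p) = c` are the ring sections of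
a ring extension `C → A` with kernel `M`, where `C` is the set `A × M` with a Witt vector addition
twisted by `c` (`FWExtension`). The graph of `φ` is an ideal `J` of `C`, and it contains the integer
`p = (p, c)` of `C`, so `C/J` is a ring of characteristic `p`; it maps onto `k` with square-zero
kernel. As `C` is the fibre product of `A` and `C/J` over `k`, a section of `C/J → k` gives a
section of `C → A`, and the latter extends `φ` because `J` maps to zero in `C/J`.

A section of a surjection `D → k` with square-zero kernel from a ring of characteristic `p` exists
by the argument for coefficient fields (`exists_section_of_charP`): the subring of `p`-th powers
meets the kernel trivially, and a maximal subring of `D` with this property that contains it is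
mapped isomorphically to `k`.

For exactness in the middle, modulo the image of `F^*(𝔪_A/𝔪_A²)` the element `w(a) ⊗ 1` depends only
on `a` modulo `𝔪_A`, and is additive in it because `w(p) ⊗ 1` vanishes; hence it defines a map from
`F^*Ω¹_k` to the cokernel, inverse to the one induced by the second map.
-/

open scoped TensorProduct

noncomputable section

namespace FrobeniusWitt

universe u v

/-! ### Polynomial identities for `P` -/

section WittP

theorem map_wittP {A : Type u} {B : Type v} [CommRing A] [CommRing B] (f : A →+* B) (p : ℕ)
    (a b : A) : f (wittP p a b) = wittP p (f a) (f b) := by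
  simp [wittP]

/-- Identities for `P` are checked in `ℤ[X₀, X₁, X₂]`, where multiplication by `p` is injective and
`p · P` is explicit, and are specialized from there. -/
theorem natCast_mvPolynomial_ne_zero (p : ℕ) [hp : Fact p.Prime] :
    (p : MvPolynomial (Fin 3) ℤ) ≠ 0 :=
  Nat.cast_ne_zero.mpr hp.out.ne_zero

variable {A : Type u} [CommRing A] (p : ℕ)

theorem wittP_comm [Fact p.Prime] (a b : A) : wittP p a b = wittP p b a := by
  have h : wittP p (MvPolynomial.X 0 : MvPolynomial (Fin 3) ℤ) (MvPolynomial.X 1)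
      = wittP p (MvPolynomial.X 1) (MvPolynomial.X 0) := by
    apply mul_left_cancel₀ (natCast_mvPolynomial_ne_zero p)
    rw [natCast_mul_wittP, natCast_mul_wittP]
    ring
  simpa [map_wittP] using congrArg (MvPolynomial.eval₂Hom (Int.castRingHom A) ![a, b, 0]) h

/-- `P` is a `2`-cocycle for addition. -/
theorem wittP_add_wittP [Fact p.Prime] (a b c : A) :
    wittP p a b + wittP p (a + b) c = wittP p b c + wittP p a (b + c) := by
  have h : wittP p (MvPolynomial.X 0 : MvPolynomial (Fin 3) ℤ) (MvPolynomial.X 1)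
        + wittP p (MvPolynomial.X 0 + MvPolynomial.X 1) (MvPolynomial.X 2)
      = wittP p (MvPolynomial.X 1) (MvPolynomial.X 2)
        + wittP p (MvPolynomial.X 0) (MvPolynomial.X 1 + MvPolynomial.X 2) := by
    apply mul_left_cancel₀ (natCast_mvPolynomial_ne_zero p)
    simp only [mul_add, natCast_mul_wittP]
    ring
  have h' := congrArg (MvPolynomial.eval₂Hom (Int.castRingHom A) ![a, b, c]) h
  simp only [map_add, map_wittP] at h'
  simpa using h'

/-- `P` is homogeneous of degree `p`. -/
theorem wittP_mul_mul (c a b : A) : wittP p (c * a) (c * b) = c ^ p * wittP p a b := by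
  rw [wittP, wittP, Finset.mul_sum]
  refine Finset.sum_congr rfl fun i hi => ?_
  have hc : c ^ p = c ^ i * c ^ (p - i) := by
    rw [← pow_add, Nat.add_sub_cancel' (Finset.mem_Ico.mp hi).2.le]
  rw [mul_pow, mul_pow, hc]
  ring

theorem wittP_zero_left (b : A) : wittP p 0 b = 0 := by
  refine Finset.sum_eq_zero fun i hi => ?_
  rw [zero_pow (by have := (Finset.mem_Ico.mp hi).1; omega), mul_zero, zero_mul]

theorem wittP_zero_right [Fact p.Prime] (a : A) : wittP p a 0 = 0 := by
  rw [wittP_comm, wittP_zero_left]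

end WittP

/-! ### The ring extension classifying FW-derivations -/

/-- For an `A`-module `M` killed by `p` and `c : M`, the ring with underlying set `A × M` and
operations `(a, x) + (b, y) = (a + b, x + y - P(a, b) • c)`,
`(a, x) * (b, y) = (a b, b ^ p • x + a ^ p • y)`. A map `w` with `w p = c` is an
FW-derivation if and only if `a ↦ (a, w a)` is a ring homomorphism. The proof `hM` is a parameter
of the type in order that the ring structure be found by instance search. -/
@[ext]
structure FWExtension (p : ℕ) {A : Type u} [CommRing A] {M : Type v} [AddCommGroup M] [Module A M]
    (c : M) (hM : ∀ x : M, (p : A) • x = 0) where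
  /-- The component in the ring. -/
  fst : A
  /-- The component in the module. -/
  snd : M

namespace FWExtension

variable {p : ℕ} {A : Type u} [CommRing A] {M : Type v} [AddCommGroup M] [Module A M] {c : M} {hM : ∀ x : M, (p : A) • x = 0}

instance : Zero (FWExtension p c hM) := ⟨⟨0, 0⟩⟩
instance : One (FWExtension p c hM) := ⟨⟨1, 0⟩⟩
instance : Add (FWExtension p c hM) :=
  ⟨fun x y => ⟨x.fst + y.fst, x.snd + y.snd - wittP p x.fst y.fst • c⟩⟩
instance : Neg (FWExtension p c hM) :=
  ⟨fun x => ⟨-x.fst, -x.snd + wittP p (-x.fst) x.fst • c⟩⟩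
instance : Mul (FWExtension p c hM) :=
  ⟨fun x y => ⟨x.fst * y.fst, y.fst ^ p • x.snd + x.fst ^ p • y.snd⟩⟩

theorem zero_def : (0 : FWExtension p c hM) = ⟨0, 0⟩ := rfl
theorem one_def : (1 : FWExtension p c hM) = ⟨1, 0⟩ := rfl
theorem add_def (x y : FWExtension p c hM) :
    x + y = ⟨x.fst + y.fst, x.snd + y.snd - wittP p x.fst y.fst • c⟩ := rfl
theorem neg_def (x : FWExtension p c hM) :
    -x = ⟨-x.fst, -x.snd + wittP p (-x.fst) x.fst • c⟩ := rfl
theorem mul_def (x y : FWExtension p c hM) :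
    x * y = ⟨x.fst * y.fst, y.fst ^ p • x.snd + x.fst ^ p • y.snd⟩ := rfl

theorem mul_comm' (x y : FWExtension p c hM) : x * y = y * x := by
  rw [mul_def, mul_def, mul_comm, add_comm]

variable [hp : Fact p.Prime]

/-- The `p`-th power map of `A` acts additively on a module killed by `p`. -/
theorem add_pow_smul (hM : ∀ x : M, (p : A) • x = 0) (a b : A) (x : M) :
    (a + b) ^ p • x = a ^ p • x + b ^ p • x := by
  have h : (a + b) ^ p = a ^ p + b ^ p + wittP p a b * (p : A) := by
    rw [mul_comm, natCast_mul_wittP]; ring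
  rw [h, add_smul, add_smul, mul_smul, hM, smul_zero, add_zero]

theorem left_distrib' (x y z : FWExtension p c hM) : x * (y + z) = x * y + x * z := by
  ext
  · exact mul_add _ _ _
  · simp only [mul_def, add_def, wittP_mul_mul, smul_sub, smul_add, add_pow_smul hM, mul_smul]
    abel

instance : CommRing (FWExtension p c hM) where
  add_assoc x y z := by
    ext
    · exact add_assoc _ _ _
    · have h := congrArg (· • c) (wittP_add_wittP p x.fst y.fst z.fst)
      simp only [add_smul] at h
      simp only [add_def]
      rw [← sub_eq_zero] at h ⊢
      rw [← neg_eq_zero, ← h]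
      abel
  zero_add x := by
    ext <;> simp [add_def, zero_def, wittP_zero_left]
  add_zero x := by
    ext <;> simp [add_def, zero_def, wittP_zero_right]
  add_comm x y := by
    rw [add_def, add_def, wittP_comm p x.fst, add_comm x.fst, add_comm x.snd]
  neg_add_cancel x := by
    ext
    · simp [add_def, neg_def, zero_def]
    · simp only [add_def, neg_def, zero_def]
      abel
  nsmul := nsmulRec
  zsmul := zsmulRec
  mul_assoc x y z := by
    ext
    · exact mul_assoc _ _ _
    · simp only [mul_def, smul_add, mul_pow, smul_smul]
      rw [← add_assoc]
      congr 2 <;> congr 1 <;> ring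
  one_mul x := by
    ext <;> simp [mul_def, one_def]
  mul_one x := by
    ext <;> simp [mul_def, one_def]
  mul_comm := mul_comm'
  left_distrib := left_distrib'
  right_distrib x y z := by
    rw [mul_comm', left_distrib', mul_comm' z x, mul_comm' z y]
  zero_mul x := by
    ext <;> simp [mul_def, zero_def, hp.out.ne_zero]
  mul_zero x := by
    ext <;> simp [mul_def, zero_def, hp.out.ne_zero]

/-- The projection to `A`. -/
def fstHom : FWExtension p c hM →+* A where
  toFun := fst
  map_one' := rfl
  map_mul' _ _ := rfl
  map_zero' := rfl
  map_add' _ _ := rfl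

/-- The second component of the integer `n` is `((n - n ^ p) / p) • c`. -/
theorem exists_natCast_eq (n : ℕ) :
    ∃ z : ℤ, p * z = n - (n : ℤ) ^ p ∧ (n : FWExtension p c hM) = ⟨n, z • c⟩ := by
  induction n with
  | zero => exact ⟨0, by simp [hp.out.ne_zero], by simp [zero_def]⟩
  | succ n ih =>
    obtain ⟨z, hz, h⟩ := ih
    refine ⟨z - wittP p (n : ℤ) 1, ?_, ?_⟩
    · rw [mul_sub, natCast_mul_wittP, hz]
      push_cast
      ring
    · have hw : ((wittP p (n : ℤ) 1 : ℤ) : A) = wittP p (n : A) 1 := by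
        simpa using map_wittP (Int.castRingHom A) p (n : ℤ) 1
      rw [Nat.cast_succ, h, add_def, one_def]
      ext
      · simp
      · simp only [sub_smul, add_zero, ← hw, Int.cast_smul_eq_zsmul]

/-- The integer `p` is `(p, c)`, in accordance with `w p = c`. -/
theorem natCast_self : (p : FWExtension p c hM) = ⟨p, c⟩ := by
  obtain ⟨z, hz, h⟩ := exists_natCast_eq (c := c) (hM := hM) p
  rw [h]
  congr 1
  -- `z = 1 - p ^ (p - 1)`, and the power has exponent at least `1`
  have hz' : z = 1 - (p : ℤ) ^ (p - 2) * p := by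
    apply mul_left_cancel₀ (Int.natCast_ne_zero.mpr hp.out.ne_zero)
    rw [hz]
    have : (p : ℤ) ^ p = p ^ (p - 2) * p ^ 2 := by
      rw [← pow_add, Nat.sub_add_cancel hp.out.two_le]
    rw [this]
    ring
  have hc : (p : ℤ) • c = 0 := by
    rw [← Int.cast_smul_eq_zsmul A, Int.cast_natCast, hM]
  rw [hz', sub_smul, one_smul, mul_smul, hc, smul_zero, sub_zero]

end FWExtension

/-! ### Coefficient fields of square-zero extensions in characteristic `p` -/

section CoefficientField

variable {p : ℕ} [hp : Fact p.Prime] {D : Type u} {k : Type v} [CommRing D] [Field k]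

/-- If a subring `S` of `D` contains all `p`-th powers and is mapped injectively to the field `k`,
then it is a field: `s⁻¹ = s ^ (p - 1) * (s⁻¹) ^ p`. -/
theorem isField_of_pow_mem (f : D →+* k) (hf : Function.Surjective f)
    (S : Subring D) (hS : ∀ d : D, d ^ p ∈ S)
    (hinj : ∀ s ∈ S, f s = 0 → s = 0) : IsField S where
  exists_pair_ne := by
    refine ⟨0, 1, fun h => ?_⟩
    have := congrArg (fun s : S => f s) h
    simp at this
  mul_comm := mul_comm
  mul_inv_cancel := by
    rintro ⟨s, hs⟩ hs0
    have hfs : f s ≠ 0 := fun h => hs0 (Subtype.ext (hinj s hs h))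
    obtain ⟨u, hu⟩ := hf (f s)⁻¹
    refine ⟨⟨s ^ (p - 1) * u ^ p, S.mul_mem (S.pow_mem hs _) (hS u)⟩, Subtype.ext ?_⟩
    have h1 : s * (s ^ (p - 1) * u ^ p) = (s * u) ^ p := by
      rw [← mul_assoc, ← pow_succ', Nat.sub_add_cancel hp.out.one_le, mul_pow]
    change s * (s ^ (p - 1) * u ^ p) = 1
    rw [← sub_eq_zero]
    refine hinj _ (S.sub_mem (h1 ▸ hS _) S.one_mem) ?_
    rw [map_sub, h1, map_pow, map_mul, hu, mul_inv_cancel₀ hfs, one_pow, map_one, sub_self]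

/-- A subring of `D` that contains all `p`-th powers and is mapped injectively to `k` can be
enlarged by any element whose image in `k` is new: the relations of that element over `S` and of
its image in `k` are generated by the same polynomial `T ^ p - x ^ p`. -/
theorem aeval_eq_zero_of_pow_mem [CharP D p] (f : D →+* k) (hf : Function.Surjective f)
    (S : Subring D) (hS : ∀ d : D, d ^ p ∈ S)
    (hinj : ∀ s ∈ S, f s = 0 → s = 0) {x : D} (hx : ∀ s ∈ S, f s ≠ f x) (q : Polynomial S)
    (hq : f (q.aeval x) = 0) : q.aeval x = 0 := by
  let : Field S := (isField_of_pow_mem f hf S hS hinj).toField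
  let : Algebra S k := (f.comp S.subtype).toAlgebra
  let g : D →ₐ[S] k := { f with commutes' := fun _ => rfl }
  have : CharP k p := charP_of_injective_ringHom (R := S) (A := k) (algebraMap S k).injective p
  let a : S := ⟨x ^ p, hS x⟩
  have hirr : Irreducible (Polynomial.X ^ p - Polynomial.C a) := by
    refine X_pow_sub_C_irreducible_of_prime hp.out fun b hb => hx b b.2 ?_
    apply frobenius_inj k p
    have := congrArg (fun s : S => f s) hb
    simpa [frobenius_def, a] using this
  have hmin : Polynomial.X ^ p - Polynomial.C a = minpoly S (f x) := by
    refine minpoly.eq_of_irreducible_of_monic hirr ?_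
      (Polynomial.monic_X_pow_sub_C a hp.out.ne_zero)
    have : algebraMap S k a = f x ^ p := by
      change f (x ^ p) = _
      rw [map_pow]
    simp [this]
  have hdvd : Polynomial.X ^ p - Polynomial.C a ∣ q := by
    rw [hmin]
    refine minpoly.dvd _ _ ?_
    rw [← hq]
    exact Polynomial.aeval_algHom_apply g x q
  obtain ⟨r, rfl⟩ := hdvd
  have : algebraMap S D a = x ^ p := rfl
  simp [this]

/-- A surjection `D → k` with square-zero kernel from a ring of characteristic `p` to a field has
a section. A maximal subring of `D` among those that contain all `p`-th powers and meet the kernel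
trivially is mapped isomorphically to `k`. -/
theorem exists_section_of_charP (p : ℕ) [hp : Fact p.Prime] [CharP D p] (f : D →+* k) (hf : Function.Surjective f)
    (hker : ∀ x y, f x = 0 → f y = 0 → x * y = 0) :
    ∃ s : k →+* D, ∀ a, f (s a) = a := by
  let T : Set (Subring D) := {S | (∀ d : D, d ^ p ∈ S) ∧ ∀ s ∈ S, f s = 0 → s = 0}
  have h0 : (frobenius D p).range ∈ T := by
    refine ⟨fun d => ⟨d, rfl⟩, ?_⟩
    rintro _ ⟨d, rfl⟩ hd
    rw [frobenius_def, map_pow] at hd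
    have hd' : f d = 0 := pow_eq_zero_iff hp.out.ne_zero |>.mp hd
    obtain ⟨q, hq⟩ := Nat.exists_eq_add_of_le hp.out.two_le
    rw [frobenius_def, hq, pow_add, pow_two, hker d d hd' hd', zero_mul]
  obtain ⟨S, -, hmax⟩ := zorn_le_nonempty₀ T (fun C hC hchain y hy => by
    have hdir : DirectedOn (· ≤ ·) C := hchain.directedOn
    refine ⟨sSup C, ⟨fun d => ?_, fun s hs h => ?_⟩, fun z hz => le_sSup hz⟩
    · exact (le_sSup hy : y ≤ sSup C) ((hC hy).1 d)
    · obtain ⟨S, hSC, hsS⟩ := (Subring.mem_sSup_of_directedOn ⟨y, hy⟩ hdir).mp hs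
      exact (hC hSC).2 s hsS h) _ h0
  obtain ⟨hS, hinj⟩ := hmax.prop
  have hsurj : Function.Surjective (f.comp S.subtype) := by
    intro b
    obtain ⟨x, rfl⟩ := hf b
    by_contra! hx
    have hx' : ∀ s ∈ S, f s ≠ f x := fun s hs => hx ⟨s, hs⟩
    have hle : S ≤ (Algebra.adjoin S {x}).toSubring := fun s hs =>
      (Algebra.adjoin S {x}).algebraMap_mem ⟨s, hs⟩
    have hmem : (Algebra.adjoin S {x}).toSubring ∈ T := by
      refine ⟨fun d => hle (hS d), fun s hs h => ?_⟩
      obtain ⟨q, rfl⟩ := Algebra.adjoin_mem_exists_aeval S x hs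
      exact aeval_eq_zero_of_pow_mem f hf S hS hinj hx' q h
    exact hx' x (hmax.le_of_ge hmem hle (Algebra.self_mem_adjoin_singleton S x)) rfl
  have hbij : Function.Bijective (f.comp S.subtype) := by
    refine ⟨(injective_iff_map_eq_zero _).mpr fun s h => ?_, hsurj⟩
    exact Subtype.ext (hinj s s.2 h)
  let e := RingEquiv.ofBijective (f.comp S.subtype) hbij
  exact ⟨S.subtype.comp e.symm.toRingHom, fun a => e.apply_symm_apply a⟩

end CoefficientField

/-! ### Extension of FW-derivations from the maximal ideal -/

section LocalRing

open IsLocalRing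

variable (p : ℕ) {A : Type u} [CommRing A] [IsLocalRing A] [CharP (ResidueField A) p]

theorem natCast_mem_maximalIdeal : (p : A) ∈ maximalIdeal A := by
  rw [← residue_eq_zero_iff, map_natCast, CharP.cast_eq_zero]

variable {p} [hp : Fact p.Prime] {M : Type v} [AddCommGroup M] [Module A M]

/-- The graph of a Frobenius-semilinear map `φ : 𝔪_A → M`, as an ideal of the ring `A × M`
attached to an element `c`. -/
def graphIdeal (c : M) (hM : ∀ x : M, (p : A) • x = 0)
    (hm : ∀ a ∈ maximalIdeal A, ∀ x : M, a • x = 0) (φ : maximalIdeal A →+ M)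
    (hφ : ∀ (a : A) (x : maximalIdeal A), φ (a • x) = a ^ p • φ x) :
    Ideal (FWExtension p c hM) where
  carrier := {y | ∃ x : maximalIdeal A, y = ⟨x, φ x⟩}
  zero_mem' := ⟨0, by simp [FWExtension.zero_def]⟩
  add_mem' := by
    rintro _ _ ⟨x, rfl⟩ ⟨y, rfl⟩
    exact ⟨x + y, by simp [FWExtension.add_def, hm _ (wittP_mem p _ x.2 _)]⟩
  smul_mem' := by
    rintro y _ ⟨x, rfl⟩
    exact ⟨y.fst • x, by
      simp [FWExtension.mul_def, hφ, hm _ (Ideal.pow_mem_of_mem _ x.2 p hp.out.pos)]⟩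

/-- Let `M` be an `A`-module killed by `𝔪_A`. Every Frobenius-semilinear map `φ : 𝔪_A → M` extends
to an FW-derivation `A → M`. -/
theorem exists_isFWDerivation_extending (hm : ∀ a ∈ maximalIdeal A, ∀ x : M, a • x = 0)
    (φ : maximalIdeal A →+ M)
    (hφ : ∀ (a : A) (x : maximalIdeal A), φ (a • x) = a ^ p • φ x) :
    ∃ w : A → M, IsFWDerivation p w ∧ ∀ x : maximalIdeal A, w x = φ x := by
  let c : M := φ ⟨p, natCast_mem_maximalIdeal p⟩
  have hM : ∀ x : M, (p : A) • x = 0 := hm _ (natCast_mem_maximalIdeal p)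
  let J : Ideal (FWExtension p c hM) := graphIdeal c hM hm φ hφ
  have hJ : ∀ y, y ∈ J ↔ ∃ x : maximalIdeal A, y = ⟨x, φ x⟩ := fun y => Iff.rfl
  let f : FWExtension p c hM ⧸ J →+* ResidueField A :=
    Ideal.Quotient.lift J ((residue A).comp FWExtension.fstHom) (by
      rintro _ ⟨x, rfl⟩
      exact (residue_eq_zero_iff _).mpr x.2)
  have hfmk : ∀ y, f (Ideal.Quotient.mk J y) = residue A y.fst := fun y => rfl
  have hf : Function.Surjective f := by
    intro b
    obtain ⟨a, rfl⟩ := residue_surjective b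
    exact ⟨Ideal.Quotient.mk J ⟨a, 0⟩, rfl⟩
  have hker : ∀ x y, f x = 0 → f y = 0 → x * y = 0 := by
    intro x y hx hy
    obtain ⟨x, rfl⟩ := Ideal.Quotient.mk_surjective x
    obtain ⟨y, rfl⟩ := Ideal.Quotient.mk_surjective y
    rw [hfmk, residue_eq_zero_iff] at hx hy
    have hxp : ∀ z : M, x.fst ^ p • z = 0 := hm _ (Ideal.pow_mem_of_mem _ hx p hp.out.pos)
    have hyp : ∀ z : M, y.fst ^ p • z = 0 := hm _ (Ideal.pow_mem_of_mem _ hy p hp.out.pos)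
    rw [← map_mul, Ideal.Quotient.eq_zero_iff_mem, hJ]
    refine ⟨x.fst • ⟨y.fst, hy⟩, ?_⟩
    rw [hφ, hxp, FWExtension.mul_def, hxp, hyp, add_zero]
    rfl
  have hp0 : (p : FWExtension p c hM ⧸ J) = 0 := by
    rw [← map_natCast (Ideal.Quotient.mk J), Ideal.Quotient.eq_zero_iff_mem, hJ,
      FWExtension.natCast_self]
    exact ⟨⟨p, natCast_mem_maximalIdeal p⟩, rfl⟩
  have : Nontrivial (FWExtension p c hM ⧸ J) := f.domain_nontrivial
  have : CharP (FWExtension p c hM ⧸ J) p :=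
    ringChar.of_eq (CharP.ringChar_of_prime_eq_zero hp.out hp0)
  obtain ⟨s, hs⟩ := exists_section_of_charP p f hf hker
  -- The quotient map identifies the fibre over `a` of the projection to `A` with the fibre over
  -- the residue class of `a` of the projection to `k`.
  have hinj : ∀ (a : A) (x y : M),
      Ideal.Quotient.mk J ⟨a, x⟩ = Ideal.Quotient.mk J ⟨a, y⟩ → x = y := by
    intro a x y h
    rw [← sub_eq_zero, ← map_sub, Ideal.Quotient.eq_zero_iff_mem, hJ] at h
    obtain ⟨z, hz⟩ := h
    rw [sub_eq_iff_eq_add, FWExtension.add_def, FWExtension.mk.injEq] at hz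
    obtain ⟨hz1, hz2⟩ := hz
    have hz0 : z = 0 := Subtype.ext (by simpa using hz1)
    simpa [hz0, wittP_zero_left] using hz2
  have hex : ∀ a : A, ∃ x : M, Ideal.Quotient.mk J ⟨a, x⟩ = s (residue A a) := by
    intro a
    obtain ⟨y, hy⟩ := Ideal.Quotient.mk_surjective (s (residue A a))
    have hya : y.fst - a ∈ maximalIdeal A := by
      rw [← residue_eq_zero_iff, map_sub, ← hfmk, hy, hs, sub_self]
    have hmem : (⟨y.fst - a, φ ⟨y.fst - a, hya⟩⟩ : FWExtension p c hM) ∈ J := ⟨⟨_, hya⟩, rfl⟩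
    refine ⟨(y - ⟨y.fst - a, φ ⟨y.fst - a, hya⟩⟩).snd, ?_⟩
    have h1 : (⟨a, (y - ⟨y.fst - a, φ ⟨y.fst - a, hya⟩⟩).snd⟩ : FWExtension p c hM)
        = y - ⟨y.fst - a, φ ⟨y.fst - a, hya⟩⟩ := by
      ext
      · exact (by ring : a = y.fst - (y.fst - a)).trans
          (map_sub FWExtension.fstHom y ⟨y.fst - a, φ ⟨y.fst - a, hya⟩⟩).symm
      · rfl
    rw [h1, map_sub, Ideal.Quotient.eq_zero_iff_mem.mpr hmem, sub_zero, hy]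
  choose w hw using hex
  have hwφ : ∀ x : maximalIdeal A, w x = φ x := by
    intro x
    apply hinj x
    rw [hw, (residue_eq_zero_iff _).mpr x.2, map_zero, eq_comm, Ideal.Quotient.eq_zero_iff_mem]
    exact ⟨x, rfl⟩
  have hwp : w (p : A) = c := hwφ ⟨p, natCast_mem_maximalIdeal p⟩
  refine ⟨w, ⟨fun a b => ?_, fun a b => ?_⟩, hwφ⟩
  · apply hinj (a + b)
    rw [hw, map_add, map_add, ← hw, ← hw, ← map_add, FWExtension.add_def, hwp]
  · apply hinj (a * b)
    rw [hw, map_mul, map_mul, ← hw, ← hw, ← map_mul, FWExtension.mul_def]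

/-! ### The three exactness assertions -/

variable (p) (A)

/-- The `A`-module `F^*(𝔪_A/𝔪_A²)` receives the FW-derivation that extends the tautological map
`a ↦ 1 ⊗ a` on `𝔪_A`; the induced linear map is a retraction of `fwCotangentMap`. -/
theorem exists_leftInverse_fwCotangentMap :
    ∃ g : FWFibre p A →ₗ[ResidueField A] FrobPullback p (ResidueField A) (CotangentSpace A),
      g ∘ₗ fwCotangentMap p A = LinearMap.id := by
  let M := FrobPullback p (ResidueField A) (CotangentSpace A)
  let : Module A M := Module.compHom M (residue A)
  have hsmul : ∀ (a : A) (x : M), a • x = residue A a • x := fun _ _ => rfl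
  have : IsScalarTower A (ResidueField A) M := ⟨fun a b x => by
    rw [hsmul, Algebra.smul_def, mul_smul, ResidueField.algebraMap_eq]⟩
  let φ : maximalIdeal A →+ M := AddMonoidHom.mk'
    (fun a => frobTmul p (1 : ResidueField A) ((maximalIdeal A).toCotangent a))
    (fun a b => by rw [map_add, frobTmul_add])
  have hφ : ∀ (a : A) (x : maximalIdeal A), φ (a • x) = a ^ p • φ x := by
    intro a x
    have h : (maximalIdeal A).toCotangent (a • x)
        = residue A a • ((maximalIdeal A).toCotangent x : CotangentSpace A) :=
      map_smul (maximalIdeal A).toCotangent a x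
    change frobTmul p 1 ((maximalIdeal A).toCotangent (a • x)) = _
    rw [h, frobTmul_smul, hsmul, map_pow, mul_one]
    change _ = _ • frobTmul p (1 : ResidueField A) ((maximalIdeal A).toCotangent x)
    rw [smul_frobTmul, mul_one]
  obtain ⟨w, hw, hwφ⟩ := exists_isFWDerivation_extending
    (fun a ha x => by rw [hsmul, (residue_eq_zero_iff a).mpr ha, zero_smul]) φ hφ
  refine ⟨(liftFW hw).liftBaseChange (ResidueField A), LinearMap.ext fun x => ?_⟩
  induction x using frobPullback_induction with
  | zero => simp only [map_zero]
  | add x y hx hy => rw [map_add, hx, hy, map_add]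
  | tmul b m =>
    obtain ⟨a, rfl⟩ := (maximalIdeal A).toCotangent_surjective m
    rw [LinearMap.comp_apply, fwCotangentMap_apply, LinearMap.liftBaseChange_tmul, liftFW_univW,
      hwφ]
    change b • frobTmul p (1 : ResidueField A) ((maximalIdeal A).toCotangent a) = _
    rw [smul_frobTmul, mul_one]
    rfl

end LocalRing

/-- A `k`-module `N`, regarded as a `k`-module by restriction of scalars along the Frobenius. -/
def FrobRestrict (_p : ℕ) (_k : Type u) (N : Type v) : Type v := N

section FrobRestrict

variable (p : ℕ) (k : Type u) [CommRing k] [ExpChar k p] (N : Type v) [AddCommGroup N] [Module k N]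

instance : AddCommGroup (FrobRestrict p k N) := inferInstanceAs (AddCommGroup N)

instance : Module k (FrobRestrict p k N) := Module.compHom N (frobenius k p)

variable {p k N}

/-- The `k`-linear map `F^*Ω¹_k → N` attached to an additive map `δ : k → N` with
`δ (a b) = a ^ p • δ b + b ^ p • δ a`. -/
theorem exists_frobPullback_kaehler_lift (δ : k →+ N)
    (hδ : ∀ a b, δ (a * b) = a ^ p • δ b + b ^ p • δ a) :
    ∃ g : FrobPullback p k (Ω[k⁄ℤ]) →ₗ[k] N,
      ∀ c a, g (frobTmul p c (KaehlerDifferential.D ℤ k a)) = c • δ a := by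
  let δ' : k →+ FrobRestrict p k N := δ
  let d : Derivation ℤ k (FrobRestrict p k N) := Derivation.mk' δ'.toIntLinearMap hδ
  let h : Ω[k⁄ℤ] →ₛₗ[frobenius k p] N :=
    { toFun := fun x => d.liftKaehlerDifferential x
      map_add' := fun x y => map_add d.liftKaehlerDifferential x y
      map_smul' := fun c x => map_smul d.liftKaehlerDifferential c x }
  refine ⟨frobLift h, fun c a => ?_⟩
  rw [frobLift_frobTmul]
  exact congrArg (c • ·) (d.liftKaehlerDifferential_comp_D a)

end FrobRestrict

section LocalRing

open IsLocalRing

variable (p : ℕ) [hp : Fact p.Prime] (A : Type u) [CommRing A] [IsLocalRing A]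
  [CharP (ResidueField A) p]

theorem fwResidueMap_comp_fwCotangentMap (x) : fwResidueMap p A (fwCotangentMap p A x) = 0 := by
  induction x using frobPullback_induction with
  | zero => simp only [map_zero]
  | add x y hx hy => rw [map_add, map_add, hx, hy, add_zero]
  | tmul b m =>
    obtain ⟨a, rfl⟩ := (maximalIdeal A).toCotangent_surjective m
    rw [fwCotangentMap_apply, fwResidueMap_apply, (residue_eq_zero_iff _).mpr a.2, map_zero,
      frobTmul_zero]

/-- Modulo the image of `fwCotangentMap` the class of `w a` depends only on the residue class of
`a`, and additively so because `w p` vanishes there. It therefore defines a linear map on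
`F^*Ω¹_k`, inverse to the map that `fwResidueMap` induces. -/
theorem exists_comp_fwResidueMap_eq_mkQ :
    ∃ g : FrobPullback p (ResidueField A) (Ω[ResidueField A⁄ℤ]) →ₗ[ResidueField A]
        FWFibre p A ⧸ LinearMap.range (fwCotangentMap p A),
      g ∘ₗ fwResidueMap p A = (LinearMap.range (fwCotangentMap p A)).mkQ := by
  let q := (LinearMap.range (fwCotangentMap p A)).mkQ
  let v : A → FWFibre p A ⧸ LinearMap.range (fwCotangentMap p A) :=
    fun a => q (1 ⊗ₜ[A] univW p a)
  have hsmul : ∀ (a : A) (x : FWDifferentials p A),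
      q (1 ⊗ₜ[A] (a • x)) = residue A a • q (1 ⊗ₜ[A] x) := by
    intro a x
    rw [TensorProduct.tmul_smul, ← map_smul, ← ResidueField.algebraMap_eq, algebraMap_smul]
  have hv0 : ∀ a ∈ maximalIdeal A, v a = 0 := by
    intro a ha
    refine (Submodule.Quotient.mk_eq_zero _).mpr
      ⟨frobTmul p 1 ((maximalIdeal A).toCotangent ⟨a, ha⟩), ?_⟩
    rw [fwCotangentMap_apply]
  have hvp : q (1 ⊗ₜ[A] univW p (p : A)) = 0 := hv0 _ (natCast_mem_maximalIdeal p)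
  have hvadd : ∀ a b, v (a + b) = v a + v b := by
    intro a b
    change q _ = q _ + q _
    rw [(isFWDerivation_univW p).map_add, TensorProduct.tmul_sub, TensorProduct.tmul_add, map_sub,
      map_add, hsmul, hvp, smul_zero, sub_zero]
  have hvmul : ∀ a b, v (a * b) = residue A a ^ p • v b + residue A b ^ p • v a := by
    intro a b
    change q _ = _ • q _ + _ • q _
    rw [(isFWDerivation_univW p).map_mul, TensorProduct.tmul_add, map_add, hsmul, hsmul, map_pow,
      map_pow, add_comm]
  let δ : ResidueField A →+ FWFibre p A ⧸ LinearMap.range (fwCotangentMap p A) :=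
    QuotientAddGroup.lift (maximalIdeal A).toAddSubgroup (AddMonoidHom.mk' v hvadd) hv0
  have hδ : ∀ a, δ (residue A a) = v a := fun a => rfl
  obtain ⟨g, hg⟩ := exists_frobPullback_kaehler_lift (p := p) δ (fun a b => by
    obtain ⟨a, rfl⟩ := residue_surjective a
    obtain ⟨b, rfl⟩ := residue_surjective b
    rw [← map_mul, hδ, hδ, hδ, hvmul])
  refine ⟨g, TensorProduct.AlgebraTensorModule.ext fun b x => ?_⟩
  obtain ⟨x, rfl⟩ := Submodule.mkQ_surjective _ x
  induction x using Finsupp.induction_linear with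
  | zero => simp only [map_zero, TensorProduct.tmul_zero]
  | add x y hx hy => rw [map_add, TensorProduct.tmul_add, map_add, map_add, hx, hy]
  | single a r =>
    have h : (relations p A).mkQ (Finsupp.single a r) = r • univW p a := by
      rw [univW, ← map_smul, Finsupp.smul_single, smul_eq_mul, mul_one]
    rw [h, ← TensorProduct.smul_tmul]
    change g (fwResidueMap p A _) = q _
    rw [fwResidueMap_apply]
    refine (hg _ _).trans ?_
    change _ • q _ = q _
    rw [← map_smul, TensorProduct.smul_tmul', smul_eq_mul, mul_one]

theorem fwResidueMap_surjective : Function.Surjective (fwResidueMap p A) := by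
  rw [← LinearMap.range_eq_top, eq_top_iff]
  rintro x -
  induction x using frobPullback_induction with
  | zero => exact zero_mem _
  | add x y hx hy => exact add_mem hx hy
  | tmul b m =>
    have hm : m ∈ Submodule.span (ResidueField A)
        (Set.range (KaehlerDifferential.D ℤ (ResidueField A))) := by
      rw [KaehlerDifferential.span_range_derivation]
      trivial
    induction hm using Submodule.span_induction generalizing b with
    | zero => rw [frobTmul_zero]; exact zero_mem _
    | add x y _ _ hx hy => rw [frobTmul_add]; exact add_mem (hx b) (hy b)
    | smul r x _ hx => rw [frobTmul_smul]; exact hx _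
    | mem x hx =>
      obtain ⟨a, rfl⟩ := hx
      obtain ⟨a, rfl⟩ := residue_surjective a
      exact ⟨b ⊗ₜ[A] univW p a, fwResidueMap_apply p A b a⟩

end LocalRing

end FrobeniusWitt

end

theorem mainTheorem2 (p : ℕ) [Fact p.Prime] (A : Type*) [CommRing A] [IsLocalRing A]
    [CharP (IsLocalRing.ResidueField A) p] :
    Function.Injective (FrobeniusWitt.fwCotangentMap p A) ∧
    Function.Exact (FrobeniusWitt.fwCotangentMap p A) (FrobeniusWitt.fwResidueMap p A) ∧
    Function.Surjective (FrobeniusWitt.fwResidueMap p A) := by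
  refine ⟨?_, fun x => ⟨fun hx => ?_, ?_⟩, FrobeniusWitt.fwResidueMap_surjective p A⟩
  · obtain ⟨g, hg⟩ := FrobeniusWitt.exists_leftInverse_fwCotangentMap p A
    exact Function.LeftInverse.injective (g := g) (LinearMap.congr_fun hg)
  · obtain ⟨g, hg⟩ := FrobeniusWitt.exists_comp_fwResidueMap_eq_mkQ p A
    have h := LinearMap.congr_fun hg x
    rw [LinearMap.comp_apply, hx, map_zero] at h
    exact (Submodule.Quotient.mk_eq_zero _).mp h.symm
  · rintro ⟨y, rfl⟩
    exact FrobeniusWitt.fwResidueMap_comp_fwCotangentMap p A y
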